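/- Let $A\in[0,1]^{m\times n}$, let $a_1,\dots,a_m>0$, and let $\hat x\in[0,\infty)^n$ be a fractional solution, i.e. $A_k\cdot\hat x=\sum_i A_{ki}\hat x_i\ge a_k$ for $k=1,\dots,m$ (the entries of $\hat x$ may be arbitrarily large). Let $\sigma\in(0,1)$ and $\alpha>\frac{-\ln(1-\sigma)}{\sigma}$. RELAXATION, on input $(\hat y,A,b,\sigma,\alpha)$, is the following randomized algorithm. Draw $x_1,\dots,x_n\in\{0,1\}$ independently, $x_i\sim\mathrm{Bernoulli}(\alpha\hat y_i)$. While some constraint $A_k\cdot x\ge b_k$ fails, let $k$ be minimal with $A_k\cdot x<b_k$ and resample constraint $k$: for each $i$ with $x_i=0$, independently redraw $x_i\sim\mathrm{Bernoulli}(\sigma A_{ki}\alpha\hat y_i)$. When all constraints hold, return $x$. ROUNDING, on input $(\hat x,A,a,\sigma,\alpha)$, sets $\theta=\frac{-\ln(1-\sigma)}{\alpha\sigma}$ and, for each $i$, $v_i=\lfloor\hat x_i/\theta\rfloor$ and $F_i=\hat x_i-v_i\theta$; it sets $G_i=1$, $\hat x'_i=0$ if $F_i\ge 1/\alpha$, and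 $G_i=0$, $\hat x'_i=F_i$ otherwise. It sets $a'_k=a_k-\sum_i A_{ki}(G_i+v_i)$ for each $k$, runs RELAXATION on $(\hat x',A,a',\sigma,\alpha)$ to obtain $x'$, and returns $x=G+v+x'$. Then the call of RELAXATION made by ROUNDING terminates with probability one; the vector $x$ returned by ROUNDING satisfies, for each $i=1,\dots,n$, $$\mathbf E[x_i]\le\alpha\hat x_i\Bigl(1+\sigma\sum_{k=1}^m\frac{A_{ki}}{e^{\sigma\alpha a_k}(1-\sigma)^{a_k}-1}\Bigr);$$ and the expected number of resamplings made by this call of RELAXATION is at most $$\sum_{k=1}^m\frac{1}{e^{\sigma\alpha a_k}(1-\sigma)^{a_k}-1}.$$ -/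

import Mathlib

open MeasureTheory

noncomputable section

namespace CoveringIP

variable {m n : ℕ}

/-- The nonnegative real vector `y` satisfies `A_k · y ≥ a_k` for all `k`. -/
def FracSolution (A : Fin m → Fin n → ℝ) (a : Fin m → ℝ) (y : Fin n → ℝ) : Prop :=
  (∀ i, 0 ≤ y i) ∧ ∀ k, a k ≤ ∑ i, A k i * y i

/-! ### The algorithm RELAXATION

A state is a vector `x ∈ {0,1}ⁿ`, with `false` for `0` and `true` for `1`. -/

/-- The constraints `k` with `A_k · x < a_k`. -/
def violated (A : Fin m → Fin n → ℝ) (a : Fin m → ℝ) (x : Fin n → Bool) : Finset (Fin m) :=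
  {k | ∑ i, A k i * ((x i).toNat : ℝ) < a k}

/-- Resampling of constraint `k`: every `x i = 0` is replaced by a Bernoulli variable with
parameter `σ A_{ki} α y_i`, drawn as the indicator of `u i < σ A_{ki} α y_i` with `u i` uniform on
the unit interval; the entries equal to `1` are kept. -/
def resample (A : Fin m → Fin n → ℝ) (σ α : ℝ) (y : Fin n → ℝ) (k : Fin m)
    (x : Fin n → Bool) (u : Fin n → unitInterval) : Fin n → Bool :=
  fun i => if x i = false then decide ((u i : ℝ) < σ * A k i * α * y i) else x i

/-- One iteration of the main loop: the violated constraint of minimal index is resampled.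
When no constraint is violated the loop is over, and the state no longer changes. -/
def loopStep (A : Fin m → Fin n → ℝ) (a : Fin m → ℝ) (σ α : ℝ) (y : Fin n → ℝ)
    (x : Fin n → Bool) (u : Fin n → unitInterval) : Fin n → Bool :=
  if h : (violated A a x).Nonempty then resample A σ α y ((violated A a x).min' h) x u else x

/-- The random source: `ω t i` is the uniform number used for variable `i` in the initialization
(`t = 0`), or in the `t`-th iteration of the loop (`t ≥ 1`). -/
abbrev Source (n : ℕ) : Type := ℕ → Fin n → unitInterval

/-- All the numbers `ω t i` are independent and uniform on the unit interval. -/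
def sourceLaw (n : ℕ) : Measure (Source n) :=
  Measure.infinitePi (fun _ : ℕ => (volume : Measure (Fin n → unitInterval)))

/-- The state of RELAXATION after `t` iterations of the loop. Initially the `x i` are independent
Bernoulli variables with parameters `α y_i`. -/
def state (A : Fin m → Fin n → ℝ) (a : Fin m → ℝ) (σ α : ℝ) (y : Fin n → ℝ) (ω : Source n) :
    ℕ → Fin n → Bool
  | 0 => fun i => decide ((ω 0 i : ℝ) < α * y i)
  | t + 1 => loopStep A a σ α y (state A a σ α y ω t) (ω (t + 1))

/-- The run of RELAXATION on the source `ω` comes to an end. -/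
def Halts (A : Fin m → Fin n → ℝ) (a : Fin m → ℝ) (σ α : ℝ) (y : Fin n → ℝ) (ω : Source n) :
    Prop :=
  ∃ t, violated A a (state A a σ α y ω t) = ∅

/-- The number of resamplings, i.e. the number of times the body of the loop is executed; it is
`⊤` if the run does not end. -/
def numResamplings (A : Fin m → Fin n → ℝ) (a : Fin m → ℝ) (σ α : ℝ) (y : Fin n → ℝ)
    (ω : Source n) : ℕ∞ :=
  Set.encard {t : ℕ | (violated A a (state A a σ α y ω t)).Nonempty}

/-- The vector returned by RELAXATION: the state at the first time at which no constraint is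
violated (a dummy value, namely the initial state, if the run does not end). -/
def relaxation (A : Fin m → Fin n → ℝ) (a : Fin m → ℝ) (σ α : ℝ) (y : Fin n → ℝ)
    (ω : Source n) : Fin n → Bool :=
  state A a σ α y ω (sInf {t : ℕ | violated A a (state A a σ α y ω t) = ∅})

/-! ### The algorithm ROUNDING -/

/-- The quantization threshold `θ`. -/
def theta (σ α : ℝ) : ℝ := -Real.log (1 - σ) / (α * σ)

/-- `v_i = ⌊x̂_i / θ⌋`. -/
def quot (σ α : ℝ) (xh : Fin n → ℝ) (i : Fin n) : ℕ := ⌊xh i / theta σ α⌋₊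

/-- `F_i = x̂_i mod θ`. -/
def frac (σ α : ℝ) (xh : Fin n → ℝ) (i : Fin n) : ℝ := xh i - quot σ α xh i * theta σ α

open Classical in
/-- `G_i`: `1` if `F_i ≥ 1/α`, and `0` otherwise. -/
def bump (σ α : ℝ) (xh : Fin n → ℝ) (i : Fin n) : ℕ := if 1 / α ≤ frac σ α xh i then 1 else 0

open Classical in
/-- The residual fractional vector `x̂'`: `0` if `F_i ≥ 1/α`, and `F_i` otherwise. -/
def residual (σ α : ℝ) (xh : Fin n → ℝ) (i : Fin n) : ℝ :=
  if 1 / α ≤ frac σ α xh i then 0 else frac σ α xh i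

/-- The residual right-hand side `a'_k = a_k - ∑ i, A_{ki} (G_i + v_i)`. -/
def residualRHS (A : Fin m → Fin n → ℝ) (a : Fin m → ℝ) (σ α : ℝ) (xh : Fin n → ℝ)
    (k : Fin m) : ℝ :=
  a k - ∑ i, A k i * ((bump σ α xh i : ℝ) + (quot σ α xh i : ℝ))

/-- The vector `x = G + v + x'` returned by ROUNDING, where `x'` is the vector returned by
RELAXATION on the residual problem. -/
def rounding (A : Fin m → Fin n → ℝ) (a : Fin m → ℝ) (σ α : ℝ) (xh : Fin n → ℝ)
    (ω : Source n) (i : Fin n) : ℕ :=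
  bump σ α xh i + quot σ α xh i
    + (relaxation A (residualRHS A a σ α xh) σ α (residual σ α xh) ω i).toNat

end CoveringIP

end

open MeasureTheory ProbabilityTheory ENNReal

namespace CoveringIP

variable {m n : ℕ}

/-! RELAXATION is analysed through one potential per constraint `k`. Let `W_r(x)` (`prodWeight`) be
the expectation, for a fictitious chain started at `x` that resamples only `k`, of the product over
`r` rounds of `∏ i, (1 - σ A_{ki} x_i)`, taken at the start of each round. The potential is `∑_{r ≥
1} (1-σ)^(-b_k r) W_r(x)`.

If `k` is violated, then `(1-σ)^(-b_k) ∏ i, (1 - σ A_{ki} x_i) ≥ (1-σ)^(A_k·x - b_k) ≥ 1`, so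
resampling `k` lowers the expected potential by at least 1 (`lintegral_potential_resample`).
Resampling any other constraint only turns zeros into ones, and the potential is antitone, so it
does not grow. Telescoping bounds the expected number of resamplings of `k` by the mean initial
potential. For the Bernoulli initial state, the mean of `W_r` is exactly `(∏ i, (1 - σ A_{ki} α
y_i))^r` (`bernoulli_roundWeight`); a geometric series then gives `1/(c-1)` for every `c > 1` with
`c ≤ e^(σα A_k·y) (1-σ)^(b_k)`. Almost sure termination follows from the finite expectation, and the
mean of `x_i` from charging each resampling of `k` with its success probability `σ A_{ki} α y_i`.

For ROUNDING, `σαθ = -ln(1-σ)`, so exchanging `θ` units of `x̂_i` for one integer unit leaves `e^(σα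
A_k·y) (1-σ)^(b_k)` unchanged, and rounding up a remainder below `θ` can only increase it. Hence
`c_k = e^(σα a_k) (1-σ)^(a_k)` serves for the residual problem (`exp_mul_rpow_le_residual`). The
cost does not rise either, because `αθ ≥ 1` (`bump_add_quot_add_le`). -/

instance : IsProbabilityMeasure (sourceLaw n) := by
  unfold sourceLaw; infer_instance

/-! ### Bernoulli variables built from uniform ones -/

theorem volume_lt_real {s : ℝ} (h0 : 0 ≤ s) (h1 : s ≤ 1) :
    volume {u : unitInterval | (u : ℝ) < s} = ENNReal.ofReal s :=
  unitInterval.volume_Iio (x := ⟨s, h0, h1⟩)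

theorem measurable_decide_lt (s : ℝ) :
    Measurable fun u : unitInterval => decide ((u : ℝ) < s) := by
  refine measurable_to_bool ?_
  have : (fun u : unitInterval => decide ((u : ℝ) < s)) ⁻¹' {true}
      = {u : unitInterval | (u : ℝ) < s} := by ext u; simp
  rw [this]
  exact measurableSet_lt measurable_subtype_coe measurable_const

theorem lintegral_decide_lt {s : ℝ} (h0 : 0 ≤ s) (h1 : s ≤ 1) (g : Bool → ℝ≥0∞) :
    ∫⁻ u : unitInterval, g (decide ((u : ℝ) < s))
      = ENNReal.ofReal s * g true + ENNReal.ofReal (1 - s) * g false := by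
  have hm : MeasurableSet {u : unitInterval | (u : ℝ) < s} :=
    measurableSet_lt measurable_subtype_coe measurable_const
  rw [← lintegral_add_compl _ hm,
    setLIntegral_congr_fun (g := fun _ => g true) hm (fun u hu => by
      simp only [Set.mem_ofPred_eq] at hu; simp [hu]),
    setLIntegral_congr_fun (g := fun _ => g false) hm.compl (fun u hu => by
      simp only [Set.mem_compl_iff, Set.mem_ofPred_eq] at hu; simp [hu]),
    setLIntegral_const, setLIntegral_const, prob_compl_eq_one_sub hm, volume_lt_real h0 h1,
    ENNReal.ofReal_sub _ h0, ENNReal.ofReal_one, mul_comm (g true), mul_comm (g false)]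

theorem lintegral_prod_decide_lt {s : Fin n → ℝ} (h0 : ∀ i, 0 ≤ s i) (h1 : ∀ i, s i ≤ 1)
    (g : Fin n → Bool → ℝ≥0∞) :
    ∫⁻ u : Fin n → unitInterval, ∏ i, g i (decide ((u i : ℝ) < s i))
      = ∏ i, (ENNReal.ofReal (s i) * g i true + ENNReal.ofReal (1 - s i) * g i false) := by
  have hm : ∀ i, Measurable fun u : unitInterval => g i (decide ((u : ℝ) < s i)) := fun i =>
    (measurable_of_finite (g i)).comp (measurable_decide_lt _)
  have hi : iIndepFun (fun i (u : Fin n → unitInterval) => g i (decide ((u i : ℝ) < s i)))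
      (Measure.pi fun _ : Fin n => (volume : Measure unitInterval)) :=
    iIndepFun_pi (X := fun i (u : unitInterval) => g i (decide ((u : ℝ) < s i)))
      (fun i => (hm i).aemeasurable)
  rw [volume_pi]
  rw [lintegral_prod_eq_prod_lintegral_of_indepFun Finset.univ _ hi
    (fun i => (hm i).comp (measurable_pi_apply i))]
  refine Finset.prod_congr rfl fun i _ => ?_
  rw [← lintegral_decide_lt (h0 i) (h1 i),
    ← (measurePreserving_eval (fun _ : Fin n => (volume : Measure unitInterval)) i).lintegral_comp
      (hm i)]

/-! ### The state process is a Markov chain -/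

section Chain

variable (A : Fin m → Fin n → ℝ) (a : Fin m → ℝ) (σ α : ℝ) (y : Fin n → ℝ)

theorem measurable_resample (k : Fin m) (x : Fin n → Bool) :
    Measurable (resample A σ α y k x) := by
  refine measurable_pi_lambda _ fun i => ?_
  unfold resample
  split_ifs
  · exact (measurable_decide_lt _).comp (measurable_pi_apply i)
  · exact measurable_const

theorem measurable_loopStep (x : Fin n → Bool) : Measurable (loopStep A a σ α y x) := by
  by_cases h : (violated A a x).Nonempty
  · have : loopStep A a σ α y x = resample A σ α y ((violated A a x).min' h) x := by
      funext u; simp [loopStep, h]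
    rw [this]; exact measurable_resample ..
  · have : loopStep A a σ α y x = fun _ => x := by funext u; simp [loopStep, h]
    rw [this]; exact measurable_const

theorem measurable_uncurry_loopStep :
    Measurable fun p : (Fin n → Bool) × (Fin n → unitInterval) =>
      loopStep A a σ α y p.1 p.2 :=
  measurable_from_prod_countable_right fun x => measurable_loopStep A a σ α y x

theorem measurable_state (t : ℕ) : Measurable fun ω => state A a σ α y ω t := by
  induction t with
  | zero =>
    refine measurable_pi_lambda _ fun i => ?_
    exact (measurable_decide_lt _).comp ((measurable_pi_apply i).comp (measurable_pi_apply 0))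
  | succ t ih =>
    have h : Measurable fun ω : Source n => ω (t + 1) := measurable_pi_apply (t + 1)
    change Measurable fun ω => loopStep A a σ α y ((fun ω => state A a σ α y ω t) ω) (ω (t + 1))
    generalize (fun ω => state A a σ α y ω t) = f at ih
    have h2 := ih.prodMk h
    have h3 := (measurable_uncurry_loopStep A a σ α y).comp h2
    exact h3

theorem measurable_comp_state {β : Type*} [MeasurableSpace β] (f : (Fin n → Bool) → β) (t : ℕ) :
    Measurable fun ω => f (state A a σ α y ω t) :=
  (measurable_of_finite f).comp (measurable_state A a σ α y t)

theorem state_congr {ω ω' : Source n} {t : ℕ} (h : ∀ j ≤ t, ω j = ω' j) :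
    state A a σ α y ω t = state A a σ α y ω' t := by
  induction t with
  | zero => simp [state, h 0 le_rfl]
  | succ t ih => simp [state, ih fun j hj => h j (by omega), h (t + 1) le_rfl]

theorem indepFun_state (t : ℕ) :
    IndepFun (fun ω => state A a σ α y ω t) (fun ω : Source n => ω (t + 1)) (sourceLaw n) := by
  have hi : iIndepFun (fun (j : ℕ) (ω : Source n) => ω j) (sourceLaw n) :=
    iIndepFun_infinitePi (P := fun _ : ℕ => (volume : Measure (Fin n → unitInterval)))
      (X := fun _ u => u) (fun _ => measurable_id)
  have hST : Disjoint (Finset.range (t + 1)) {t + 1} := by simp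
  have h := hi.indepFun_finset (Finset.range (t + 1)) {t + 1} hST (fun j => measurable_pi_apply j)
  -- The state at time `t` depends only on rounds `0, …, t`, so it factors through that finite
  -- restriction; the padding value `0` is never read.
  let ext : ((j : Finset.range (t + 1)) → Fin n → unitInterval) → Source n :=
    fun r j => if hj : j ∈ Finset.range (t + 1) then r ⟨j, hj⟩ else 0
  have hext : Measurable ext := by
    refine measurable_pi_lambda _ fun j => ?_
    by_cases hj : j ∈ Finset.range (t + 1)
    · simp only [ext, hj, dite_true]; exact measurable_pi_apply _
    · simp only [ext, hj, dite_false]; exact measurable_const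
  have h2 := h.comp ((measurable_state A a σ α y t).comp hext)
    (measurable_pi_apply (⟨t + 1, by simp⟩ : ({t + 1} : Finset ℕ)))
  have he : (fun ω => state A a σ α y ω t) = ((fun ω => state A a σ α y ω t) ∘ ext) ∘
      fun (ω : Source n) (j : Finset.range (t + 1)) => ω j := by
    funext ω
    refine state_congr A a σ α y fun j hj => ?_
    simp only [ext, Finset.mem_range, Nat.lt_succ_of_le hj, dite_true]
  rw [he]
  exact h2

/-- The Markov property. -/
theorem lintegral_state_next (t : ℕ) {F : (Fin n → Bool) → (Fin n → unitInterval) → ℝ≥0∞}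
    (hF : ∀ x, Measurable (F x)) :
    ∫⁻ ω, F (state A a σ α y ω t) (ω (t + 1)) ∂sourceLaw n
      = ∫⁻ ω, (∫⁻ u, F (state A a σ α y ω t) u) ∂sourceLaw n := by
  have hm := measurable_state A a σ α y t
  have hF' : Measurable fun p : (Fin n → Bool) × (Fin n → unitInterval) => F p.1 p.2 :=
    measurable_from_prod_countable_right hF
  have hi := (indepFun_iff_map_prod_eq_prod_map_map hm.aemeasurable
    (measurable_pi_apply (t + 1)).aemeasurable).1 (indepFun_state A a σ α y t)
  have he : (sourceLaw n).map (fun ω : Source n => ω (t + 1))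
      = (volume : Measure (Fin n → unitInterval)) := Measure.infinitePi_map_eval _ (t + 1)
  rw [he] at hi
  have h1 := lintegral_map (μ := sourceLaw n) hF' (hm.prodMk (measurable_pi_apply (t + 1)))
  rw [← h1, hi, lintegral_prod _ hF'.aemeasurable, lintegral_map (measurable_of_finite _) hm]

theorem lintegral_state_zero {f : (Fin n → unitInterval) → ℝ≥0∞} (hf : Measurable f) :
    ∫⁻ ω : Source n, f (ω 0) ∂sourceLaw n = ∫⁻ u, f u := by
  have he : (sourceLaw n).map (fun ω : Source n => ω 0)
      = (volume : Measure (Fin n → unitInterval)) := Measure.infinitePi_map_eval _ 0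
  rw [← he, lintegral_map hf (measurable_pi_apply 0)]

end Chain

/-! ### The potential of a single coordinate -/

/-- For a variable that turns from `0` to `1` with probability `s` in every round, the expectation
of the product, over the first `r` rounds, of the factors `1 - τ` for each round that starts with
the value `1`. -/
def roundWeight (τ s : ℝ) : ℕ → Bool → ℝ
  | 0, _ => 1
  | r + 1, true => (1 - τ) * roundWeight τ s r true
  | r + 1, false => s * roundWeight τ s r true + (1 - s) * roundWeight τ s r false

theorem roundWeight_nonneg {τ s : ℝ} (hτ : τ ≤ 1) (hs₀ : 0 ≤ s) (hs₁ : s ≤ 1) (r : ℕ) :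
    ∀ c, 0 ≤ roundWeight τ s r c := by
  induction r with
  | zero => intro c; simp [roundWeight]
  | succ r ih =>
    rintro (_ | _)
    · exact add_nonneg (mul_nonneg hs₀ (ih _)) (mul_nonneg (by linarith) (ih _))
    · exact mul_nonneg (by linarith) (ih _)

/-- A coordinate that is already `1` is penalised in every round, one that is `0` only after it
turns. This is the source of the monotonicity of the potential. -/
theorem roundWeight_true_le_false {τ s : ℝ} (hτ₀ : 0 ≤ τ) (hτ : τ ≤ 1) (hs₀ : 0 ≤ s)
    (hs₁ : s ≤ 1) (r : ℕ) : roundWeight τ s r true ≤ roundWeight τ s r false := by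
  induction r with
  | zero => simp [roundWeight]
  | succ r ih =>
    have h := roundWeight_nonneg hτ hs₀ hs₁ r true
    simp only [roundWeight]
    nlinarith [mul_nonneg hτ₀ h, mul_le_mul_of_nonneg_left ih (sub_nonneg.2 hs₁)]

/-- Bernoulli(`p`) is an eigenvector of a round when `s = τ * p`: the mass that the factor `1 - τ`
removes from `1` is balanced by the redrawn zeros, so each round scales the law by `1 - τ * p`. -/
theorem bernoulli_roundWeight (τ p : ℝ) (r : ℕ) :
    p * roundWeight τ (τ * p) r true + (1 - p) * roundWeight τ (τ * p) r false
      = (1 - τ * p) ^ r := by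
  induction r with
  | zero => simp [roundWeight]
  | succ r ih =>
    rw [pow_succ, ← ih]
    simp only [roundWeight]
    ring

/-! ### The potential of a constraint -/

section Potential

variable (A : Fin m → Fin n → ℝ) (b : Fin m → ℝ) (σ α : ℝ) (y : Fin n → ℝ)

/-- The product of the coordinate weights for `r` rounds of resampling constraint `k`. -/
noncomputable def prodWeight (k : Fin m) (r : ℕ) (x : Fin n → Bool) : ℝ≥0∞ :=
  ∏ i, ENNReal.ofReal (roundWeight (σ * A k i) (σ * A k i * (α * y i)) r (x i))

/-- An upper bound for the expected number of future resamplings of constraint `k`. -/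
noncomputable def potential (k : Fin m) (x : Fin n → Bool) : ℝ≥0∞ :=
  ∑' r : ℕ, ENNReal.ofReal ((1 - σ) ^ (-b k)) ^ (r + 1) * prodWeight A σ α y k (r + 1) x

/-- The states in which the loop resamples constraint `k`. -/
def resampling (k : Fin m) : Set (Fin n → Bool) :=
  {x | ∃ h : (violated A b x).Nonempty, (violated A b x).min' h = k}

variable {A b σ α y}

theorem rate_bounds (hA : ∀ k i, 0 ≤ A k i ∧ A k i ≤ 1) (hσ₀ : 0 < σ) (hσ₁ : σ < 1)
    (hy : ∀ i, 0 ≤ α * y i ∧ α * y i ≤ 1) (k : Fin m) (i : Fin n) :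
    (0 ≤ σ * A k i ∧ σ * A k i ≤ 1) ∧
      0 ≤ σ * A k i * (α * y i) ∧ σ * A k i * (α * y i) ≤ 1 := by
  have h0 : 0 ≤ σ * A k i := mul_nonneg hσ₀.le (hA k i).1
  have h1 : σ * A k i ≤ 1 := mul_le_one₀ hσ₁.le (hA k i).1 (hA k i).2
  exact ⟨⟨h0, h1⟩, mul_nonneg h0 (hy i).1, mul_le_one₀ h1 (hy i).1 (hy i).2⟩

/-- First-step decomposition of the fictitious chain; independence of the redraws reduces it to the
recursion of `roundWeight` in each coordinate. -/
theorem lintegral_prodWeight_resample (hA : ∀ k i, 0 ≤ A k i ∧ A k i ≤ 1) (hσ₀ : 0 < σ)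
    (hσ₁ : σ < 1) (hy : ∀ i, 0 ≤ α * y i ∧ α * y i ≤ 1) (k : Fin m) (r : ℕ) (x : Fin n → Bool) :
    (∏ i, ENNReal.ofReal (1 - σ * (A k i * (x i).toNat))) *
        ∫⁻ u, prodWeight A σ α y k r (resample A σ α y k x u)
      = prodWeight A σ α y k (r + 1) x := by
  have hb := rate_bounds hA hσ₀ hσ₁ hy k
  have h := lintegral_prod_decide_lt (n := n) (s := fun i => σ * A k i * (α * y i))
    (fun i => (hb i).2.1) (fun i => (hb i).2.2) (fun i c => ENNReal.ofReal
      (roundWeight (σ * A k i) (σ * A k i * (α * y i)) r (if x i = false then c else x i)))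
  have he : ∀ u, prodWeight A σ α y k r (resample A σ α y k x u) = ∏ i, ENNReal.ofReal
      (roundWeight (σ * A k i) (σ * A k i * (α * y i)) r
        (if x i = false then decide ((u i : ℝ) < σ * A k i * (α * y i)) else x i)) := by
    intro u
    simp only [prodWeight, resample, mul_assoc]
  simp_rw [he]
  rw [h, ← Finset.prod_mul_distrib]
  refine Finset.prod_congr rfl fun i _ => ?_
  obtain ⟨⟨h0, h1⟩, h2, h3⟩ := hb i
  have hw := roundWeight_nonneg h1 h2 h3 r
  cases hx : x i
  · simp only [Bool.toNat_false, Nat.cast_zero, mul_zero, sub_zero, ENNReal.ofReal_one, one_mul,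
      if_true, roundWeight]
    rw [← ENNReal.ofReal_mul h2, ← ENNReal.ofReal_mul (by linarith),
      ← ENNReal.ofReal_add (mul_nonneg h2 (hw _)) (mul_nonneg (by linarith) (hw _))]
  · simp only [Bool.toNat_true, Nat.cast_one, mul_one, Bool.true_eq_false, if_false, roundWeight]
    rw [← add_mul, ← ENNReal.ofReal_add h2 (by linarith), ENNReal.ofReal_mul (by linarith)]
    simp

theorem rpow_one_sub_le (hσ₁ : σ < 1) {c : ℝ} (h0 : 0 ≤ c) (h1 : c ≤ 1) :
    (1 - σ) ^ c ≤ 1 - σ * c := by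
  have := rpow_one_add_le_one_add_mul_self (s := -σ) (by linarith) h0 h1
  convert this using 1 <;> ring_nf

/-- Bernoulli's inequality, available since `A k i ≤ 1`, bounds the product below by
`(1-σ)^(A_k·x)`, and violation makes the total exponent negative. -/
theorem one_le_of_violated (hA : ∀ k i, 0 ≤ A k i ∧ A k i ≤ 1) (hσ₀ : 0 < σ) (hσ₁ : σ < 1)
    {k : Fin m} {x : Fin n → Bool} (hk : k ∈ violated A b x) :
    1 ≤ ENNReal.ofReal ((1 - σ) ^ (-b k)) *
      ∏ i, ENNReal.ofReal (1 - σ * (A k i * (x i).toNat)) := by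
  have hv : ∑ i, A k i * ((x i).toNat : ℝ) < b k := by simpa [violated] using hk
  have hpos : 0 < 1 - σ := by linarith
  have hc : ∀ i, 0 ≤ A k i * ((x i).toNat : ℝ) ∧ A k i * ((x i).toNat : ℝ) ≤ 1 := by
    intro i; cases x i <;> simp [hA k i]
  have hle : ∀ i, (1 - σ) ^ (A k i * ((x i).toNat : ℝ)) ≤ 1 - σ * (A k i * (x i).toNat) :=
    fun i => rpow_one_sub_le hσ₁ (hc i).1 (hc i).2
  have hnn : ∀ i, 0 ≤ 1 - σ * (A k i * ((x i).toNat : ℝ)) :=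
    fun i => (Real.rpow_nonneg hpos.le _).trans (hle i)
  rw [← ENNReal.ofReal_prod_of_nonneg (fun i _ => hnn i),
    ← ENNReal.ofReal_mul (Real.rpow_nonneg hpos.le _), ← ENNReal.ofReal_one]
  refine ENNReal.ofReal_le_ofReal ?_
  calc (1 : ℝ) ≤ (1 - σ) ^ (-b k + ∑ i, A k i * ((x i).toNat : ℝ)) :=
        Real.one_le_rpow_of_pos_of_le_one_of_nonpos hpos (by linarith) (by linarith)
    _ = (1 - σ) ^ (-b k) * ∏ i, (1 - σ) ^ (A k i * ((x i).toNat : ℝ)) := by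
        rw [Real.rpow_add hpos, Real.rpow_sum_of_pos hpos]
    _ ≤ _ := by
        refine mul_le_mul_of_nonneg_left ?_ (Real.rpow_nonneg hpos.le _)
        exact Finset.prod_le_prod (fun i _ => Real.rpow_nonneg hpos.le _) (fun i _ => hle i)

theorem prodWeight_antitone (hA : ∀ k i, 0 ≤ A k i ∧ A k i ≤ 1) (hσ₀ : 0 < σ)
    (hσ₁ : σ < 1) (hy : ∀ i, 0 ≤ α * y i ∧ α * y i ≤ 1) (k : Fin m) (r : ℕ) :
    Antitone (prodWeight A σ α y k r) := by
  intro x x' hxx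
  refine Finset.prod_le_prod' fun i _ => ENNReal.ofReal_le_ofReal ?_
  obtain ⟨⟨h0, h1⟩, h2, h3⟩ := rate_bounds hA hσ₀ hσ₁ hy k i
  have h := hxx i
  cases hx : x i <;> cases hx' : x' i
  · exact le_rfl
  · exact roundWeight_true_le_false h0 h1 h2 h3 r
  · rw [hx, hx'] at h
    exact absurd (h rfl) Bool.false_ne_true
  · exact le_rfl

theorem potential_antitone (hA : ∀ k i, 0 ≤ A k i ∧ A k i ≤ 1) (hσ₀ : 0 < σ)
    (hσ₁ : σ < 1) (hy : ∀ i, 0 ≤ α * y i ∧ α * y i ≤ 1) (k : Fin m) :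
    Antitone (potential A b σ α y k) := fun _ _ hxx =>
  ENNReal.tsum_le_tsum fun r =>
    mul_le_mul_right (prodWeight_antitone hA hσ₀ hσ₁ hy k (r + 1) hxx) _

/-! ### Decrease of the potential along the loop. -/

theorem le_loopStep (x : Fin n → Bool) (u : Fin n → unitInterval) :
    x ≤ loopStep A b σ α y x u := by
  intro i
  unfold loopStep resample
  split_ifs with h
  · by_cases hx : x i = false <;> simp [hx]
  · exact le_rfl

theorem loopStep_of_mem_resampling {k : Fin m} {x : Fin n → Bool} (hx : x ∈ resampling A b k) :
    loopStep A b σ α y x = resample A σ α y k x := by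
  obtain ⟨h, rfl⟩ := hx
  funext u
  simp [loopStep, h]

theorem lintegral_potential_resample (hA : ∀ k i, 0 ≤ A k i ∧ A k i ≤ 1) (hσ₀ : 0 < σ)
    (hσ₁ : σ < 1) (hy : ∀ i, 0 ≤ α * y i ∧ α * y i ≤ 1) {k : Fin m} {x : Fin n → Bool}
    (hk : k ∈ violated A b x) :
    1 + ∫⁻ u, potential A b σ α y k (resample A σ α y k x u) ≤ potential A b σ α y k x := by
  set D := ENNReal.ofReal ((1 - σ) ^ (-b k)) with hD
  set W := ∏ i, ENNReal.ofReal (1 - σ * (A k i * (x i).toNat)) with hW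
  set I : ℕ → ℝ≥0∞ := fun r => ∫⁻ u, prodWeight A σ α y k r (resample A σ α y k x u) with hI
  have hDW : 1 ≤ D * W := one_le_of_violated hA hσ₀ hσ₁ hk
  have hmeas : ∀ r, Measurable fun u => prodWeight A σ α y k r (resample A σ α y k x u) :=
    fun r => (measurable_of_finite (prodWeight A σ α y k r)).comp (measurable_resample A σ α y k x)
  have h1 : potential A b σ α y k x = D * W * ∑' r : ℕ, D ^ r * I r := by
    rw [← ENNReal.tsum_mul_left, potential]
    refine tsum_congr fun r => ?_
    rw [← lintegral_prodWeight_resample hA hσ₀ hσ₁ hy, pow_succ]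
    ring
  have h2 : ∫⁻ u, potential A b σ α y k (resample A σ α y k x u)
      = ∑' r : ℕ, D ^ (r + 1) * I (r + 1) := by
    simp only [potential]
    rw [lintegral_tsum fun r => ((hmeas _).const_mul _).aemeasurable]
    exact tsum_congr fun r => lintegral_const_mul _ (hmeas _)
  -- The term `r = 0` equals 1 because the empty product of rounds has weight 1; it pays for the
  -- current resampling. In `ℝ≥0∞` this needs no convergence.
  have h3 : ∑' r : ℕ, D ^ r * I r = 1 + ∑' r : ℕ, D ^ (r + 1) * I (r + 1) := by
    rw [tsum_eq_zero_add' ENNReal.summable]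
    simp [hI, prodWeight, roundWeight]
  rw [h1, h2, ← h3]
  exact le_mul_of_one_le_left' hDW

theorem lintegral_potential_loopStep (hA : ∀ k i, 0 ≤ A k i ∧ A k i ≤ 1) (hσ₀ : 0 < σ)
    (hσ₁ : σ < 1) (hy : ∀ i, 0 ≤ α * y i ∧ α * y i ≤ 1) (k : Fin m) (x : Fin n → Bool) :
    (resampling A b k).indicator 1 x + ∫⁻ u, potential A b σ α y k (loopStep A b σ α y x u)
      ≤ potential A b σ α y k x := by
  by_cases hx : x ∈ resampling A b k
  · rw [Set.indicator_of_mem hx, Pi.one_apply, loopStep_of_mem_resampling hx]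
    refine lintegral_potential_resample hA hσ₀ hσ₁ hy ?_
    obtain ⟨h, rfl⟩ := hx
    exact Finset.min'_mem _ h
  · rw [Set.indicator_of_notMem hx, zero_add]
    calc ∫⁻ u, potential A b σ α y k (loopStep A b σ α y x u)
        ≤ ∫⁻ _ : Fin n → unitInterval, potential A b σ α y k x :=
          lintegral_mono fun u => potential_antitone hA hσ₀ hσ₁ hy k (le_loopStep x u)
      _ = _ := by simp

theorem sum_resampling_add_potential_le (hA : ∀ k i, 0 ≤ A k i ∧ A k i ≤ 1) (hσ₀ : 0 < σ)
    (hσ₁ : σ < 1) (hy : ∀ i, 0 ≤ α * y i ∧ α * y i ≤ 1) (k : Fin m) (T : ℕ) :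
    (∑ t ∈ Finset.range T,
        ∫⁻ ω, (resampling A b k).indicator 1 (state A b σ α y ω t) ∂sourceLaw n) +
      ∫⁻ ω, potential A b σ α y k (state A b σ α y ω T) ∂sourceLaw n
      ≤ ∫⁻ ω, potential A b σ α y k (state A b σ α y ω 0) ∂sourceLaw n := by
  induction T with
  | zero => simp
  | succ T ih =>
    refine le_trans ?_ ih
    rw [Finset.sum_range_succ, add_assoc]
    refine add_le_add_right ?_ _
    have h := lintegral_state_next A b σ α y T
      (F := fun x u => potential A b σ α y k (loopStep A b σ α y x u))
      (fun x => (measurable_of_finite (potential A b σ α y k)).comp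
        (measurable_loopStep A b σ α y x))
    have hi : Measurable fun ω => (resampling A b k).indicator (1 : (Fin n → Bool) → ℝ≥0∞)
        (state A b σ α y ω T) :=
      measurable_comp_state A b σ α y _ T
    change _ + ∫⁻ ω, potential A b σ α y k
      (loopStep A b σ α y (state A b σ α y ω T) (ω (T + 1))) ∂sourceLaw n ≤ _
    rw [h, ← lintegral_add_left hi]
    exact lintegral_mono fun ω => lintegral_potential_loopStep hA hσ₀ hσ₁ hy k _

/-! ### The mean potential of the initial state. -/

theorem lintegral_prodWeight_zero (hA : ∀ k i, 0 ≤ A k i ∧ A k i ≤ 1) (hσ₀ : 0 < σ)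
    (hσ₁ : σ < 1) (hy : ∀ i, 0 ≤ α * y i ∧ α * y i ≤ 1) (k : Fin m) (r : ℕ) :
    ∫⁻ ω, prodWeight A σ α y k r (state A b σ α y ω 0) ∂sourceLaw n
      = (∏ i, ENNReal.ofReal (1 - σ * A k i * (α * y i))) ^ r := by
  have hm : Measurable fun u : Fin n → unitInterval =>
      prodWeight A σ α y k r fun i => decide ((u i : ℝ) < α * y i) :=
    (measurable_of_finite (prodWeight A σ α y k r)).comp (measurable_pi_lambda _ fun i =>
      (measurable_decide_lt _).comp (measurable_pi_apply i))
  have h := lintegral_state_zero hm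
  refine h.trans ?_
  simp only [prodWeight]
  rw [lintegral_prod_decide_lt (fun i => (hy i).1) (fun i => (hy i).2) (fun i c =>
    ENNReal.ofReal (roundWeight (σ * A k i) (σ * A k i * (α * y i)) r c)), ← Finset.prod_pow]
  refine Finset.prod_congr rfl fun i _ => ?_
  obtain ⟨⟨h0, h1⟩, h2, h3⟩ := rate_bounds hA hσ₀ hσ₁ hy k i
  have hw := roundWeight_nonneg h1 h2 h3 r
  have hp := sub_nonneg.2 (hy i).2
  rw [← ENNReal.ofReal_mul (hy i).1, ← ENNReal.ofReal_mul hp,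
    ← ENNReal.ofReal_add (mul_nonneg (hy i).1 (hw _)) (mul_nonneg hp (hw _)),
    bernoulli_roundWeight, ENNReal.ofReal_pow (by linarith)]

/-- By `1 - z ≤ e^(-z)` the terms are dominated by `c⁻¹ ^ (r + 1)`. The free lower bound `c` lets
the estimate for the residual data be stated in terms of the original `a k`; no sign of `b k` is
required. -/
theorem lintegral_potential_zero_le (hA : ∀ k i, 0 ≤ A k i ∧ A k i ≤ 1) (hσ₀ : 0 < σ)
    (hσ₁ : σ < 1) (hy : ∀ i, 0 ≤ α * y i ∧ α * y i ≤ 1) (k : Fin m) {c : ℝ} (hc : 1 < c)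
    (hck : c ≤ Real.exp (σ * α * ∑ i, A k i * y i) * (1 - σ) ^ b k) :
    ∫⁻ ω, potential A b σ α y k (state A b σ α y ω 0) ∂sourceLaw n
      ≤ ENNReal.ofReal (1 / (c - 1)) := by
  have hpos : 0 < 1 - σ := by linarith
  have hs : ∀ i, 0 ≤ 1 - σ * A k i * (α * y i) := fun i =>
    sub_nonneg.2 (rate_bounds hA hσ₀ hσ₁ hy k i).2.2
  have hq : ENNReal.ofReal ((1 - σ) ^ (-b k)) * ∏ i, ENNReal.ofReal (1 - σ * A k i * (α * y i))
      ≤ ENNReal.ofReal c⁻¹ := by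
    rw [← ENNReal.ofReal_prod_of_nonneg fun i _ => hs i,
      ← ENNReal.ofReal_mul (Real.rpow_nonneg hpos.le _)]
    refine ENNReal.ofReal_le_ofReal ?_
    calc (1 - σ) ^ (-b k) * ∏ i, (1 - σ * A k i * (α * y i))
        ≤ (1 - σ) ^ (-b k) * ∏ i, Real.exp (-(σ * A k i * (α * y i))) := by
          refine mul_le_mul_of_nonneg_left ?_ (Real.rpow_nonneg hpos.le _)
          exact Finset.prod_le_prod (fun i _ => hs i) fun i _ => Real.one_sub_le_exp_neg _
      _ = (Real.exp (σ * α * ∑ i, A k i * y i) * (1 - σ) ^ b k)⁻¹ := by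
          rw [mul_inv, ← Real.exp_neg, Real.rpow_neg hpos.le, ← Real.exp_sum, mul_comm,
            Finset.sum_neg_distrib, Finset.mul_sum]
          congr 3
          exact Finset.sum_congr rfl fun i _ => by ring
      _ ≤ c⁻¹ := inv_anti₀ (by linarith) hck
  have hm : ∀ r, Measurable fun ω => prodWeight A σ α y k r (state A b σ α y ω 0) :=
    fun r => measurable_comp_state A b σ α y _ 0
  have hc0 : 0 ≤ c⁻¹ := inv_nonneg.2 (by linarith)
  have hc1 : c⁻¹ < 1 := inv_lt_one_of_one_lt₀ hc
  have hgeo : HasSum (fun r : ℕ => c⁻¹ ^ (r + 1)) (1 / (c - 1)) := by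
    have h := (hasSum_geometric_of_lt_one hc0 hc1).mul_left c⁻¹
    simp only [← pow_succ'] at h
    have h1 : c - 1 ≠ 0 := by linarith
    have h2 : c ≠ 0 := by linarith
    have h3 : 1 - c⁻¹ = (c - 1) / c := by field_simp
    have h4 : c⁻¹ * (1 - c⁻¹)⁻¹ = 1 / (c - 1) := by rw [h3]; field_simp
    rwa [h4] at h
  calc ∫⁻ ω, potential A b σ α y k (state A b σ α y ω 0) ∂sourceLaw n
      = ∑' r : ℕ, (ENNReal.ofReal ((1 - σ) ^ (-b k)) *
          ∏ i, ENNReal.ofReal (1 - σ * A k i * (α * y i))) ^ (r + 1) := by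
        simp only [potential]
        rw [lintegral_tsum fun r => ((hm _).const_mul _).aemeasurable]
        refine tsum_congr fun r => ?_
        rw [lintegral_const_mul _ (hm _), lintegral_prodWeight_zero hA hσ₀ hσ₁ hy, mul_pow]
    _ ≤ ∑' r : ℕ, ENNReal.ofReal (c⁻¹ ^ (r + 1)) := by
        refine ENNReal.tsum_le_tsum fun r => ?_
        rw [ENNReal.ofReal_pow hc0]
        exact pow_le_pow_left' hq _
    _ = ENNReal.ofReal (1 / (c - 1)) := by
        rw [← ENNReal.ofReal_tsum_of_nonneg (fun r => pow_nonneg hc0 _) hgeo.summable,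
          hgeo.tsum_eq]

/-- The expected number of resamplings of constraint `k`. -/
theorem tsum_resampling_le (hA : ∀ k i, 0 ≤ A k i ∧ A k i ≤ 1) (hσ₀ : 0 < σ)
    (hσ₁ : σ < 1) (hy : ∀ i, 0 ≤ α * y i ∧ α * y i ≤ 1) (k : Fin m) {c : ℝ} (hc : 1 < c)
    (hck : c ≤ Real.exp (σ * α * ∑ i, A k i * y i) * (1 - σ) ^ b k) :
    ∑' t : ℕ, ∫⁻ ω, (resampling A b k).indicator 1 (state A b σ α y ω t) ∂sourceLaw n
      ≤ ENNReal.ofReal (1 / (c - 1)) :=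
  ENNReal.tsum_le_of_sum_range_le fun T =>
    le_self_add.trans ((sum_resampling_add_potential_le hA hσ₀ hσ₁ hy k T).trans
      (lintegral_potential_zero_le hA hσ₀ hσ₁ hy k hc hck))

end Potential

/-! ### Analysis of RELAXATION -/

section Relaxation

variable (A : Fin m → Fin n → ℝ) (b : Fin m → ℝ) (σ α : ℝ) (y : Fin n → ℝ)

theorem sum_indicator_resampling (x : Fin n → Bool) :
    ∑ k, (resampling A b k).indicator (1 : (Fin n → Bool) → ℝ≥0∞) x
      = {z | (violated A b z).Nonempty}.indicator 1 x := by
  by_cases h : (violated A b x).Nonempty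
  · rw [Finset.sum_eq_single ((violated A b x).min' h)]
    · rw [Set.indicator_of_mem (show x ∈ resampling A b _ from ⟨h, rfl⟩),
        Set.indicator_of_mem (show x ∈ {z | (violated A b z).Nonempty} from h)]
    · intro k _ hk
      exact Set.indicator_of_notMem (fun h' => h'.elim fun _ he => hk he.symm) _
    · simp
  · rw [Set.indicator_of_notMem (show x ∉ {z | (violated A b z).Nonempty} from h)]
    exact Finset.sum_eq_zero fun k _ => Set.indicator_of_notMem (fun h' => h'.elim fun h'' _ => h h'') _

theorem numResamplings_eq_tsum (ω : Source n) :
    (numResamplings A b σ α y ω : ℝ≥0∞) = ∑' t : ℕ, ∑ k,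
      (resampling A b k).indicator (1 : (Fin n → Bool) → ℝ≥0∞) (state A b σ α y ω t) := by
  rw [numResamplings, ← ENNReal.tsum_set_one,
    tsum_subtype {t : ℕ | (violated A b (state A b σ α y ω t)).Nonempty} fun _ => (1 : ℝ≥0∞)]
  refine tsum_congr fun t => ?_
  rw [sum_indicator_resampling]
  rfl

theorem measurable_numResamplings :
    Measurable fun ω => (numResamplings A b σ α y ω : ℝ≥0∞) := by
  simp_rw [numResamplings_eq_tsum]
  exact Measurable.tsum fun t => Finset.measurable_sum _ fun k _ =>
    measurable_comp_state A b σ α y _ t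

theorem measurable_relaxation : Measurable (relaxation A b σ α y) := by
  classical
  let E : Source n → ℕ → Prop := fun ω t => violated A b (state A b σ α y ω t) = ∅
  have hE : ∀ t, MeasurableSet {ω | E ω t} := fun t =>
    measurable_state A b σ α y t (Set.toFinite {x | violated A b x = ∅}).measurableSet
  -- The second alternative makes the search total: on a run that never halts it returns 0, which
  -- agrees with `sInf ∅ = 0`.
  have hp : ∀ ω, ∃ t, E ω t ∨ ∀ j, ¬ E ω j := fun ω => by
    by_cases h : ∃ t, E ω t
    · exact h.imp fun t ht => Or.inl ht
    · exact ⟨0, Or.inr (not_exists.1 h)⟩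
  have hN : Measurable fun ω => Nat.find (hp ω) := measurable_find hp fun t => by
    have he : {ω | E ω t ∨ ∀ j, ¬ E ω j} = {ω | E ω t} ∪ ⋂ j, {ω | E ω j}ᶜ := by
      ext ω; simp
    rw [he]
    exact (hE t).union (MeasurableSet.iInter fun j => (hE j).compl)
  have hs : ∀ ω, sInf {t | E ω t} = Nat.find (hp ω) := fun ω => by
    by_cases h : ∃ t, E ω t
    · refine ((Nat.find_eq_iff _).2 ⟨Or.inl (Nat.sInf_mem (s := {t | E ω t}) h), ?_⟩).symm
      exact fun j hj hj' => Nat.notMem_of_lt_sInf hj (hj'.resolve_right fun hn => h.elim hn)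
    · rw [show {t | E ω t} = ∅ from Set.eq_empty_of_forall_notMem (not_exists.1 h), Nat.sInf_empty,
        eq_comm, Nat.find_eq_zero]
      exact Or.inr (not_exists.1 h)
  have hu : Measurable fun p : Source n × ℕ => state A b σ α y p.1 p.2 :=
    measurable_from_prod_countable_left fun t => measurable_state A b σ α y t
  have h := hu.comp (measurable_id.prodMk hN)
  have he : relaxation A b σ α y = fun ω => state A b σ α y ω (Nat.find (hp ω)) := by
    funext ω
    rw [← hs ω]
    rfl
  rw [he]
  exact h

variable {A b σ α y}

theorem lintegral_numResamplings_le (hA : ∀ k i, 0 ≤ A k i ∧ A k i ≤ 1) (hσ₀ : 0 < σ)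
    (hσ₁ : σ < 1) (hy : ∀ i, 0 ≤ α * y i ∧ α * y i ≤ 1) {c : Fin m → ℝ} (hc : ∀ k, 1 < c k)
    (hck : ∀ k, c k ≤ Real.exp (σ * α * ∑ i, A k i * y i) * (1 - σ) ^ b k) :
    ∫⁻ ω, (numResamplings A b σ α y ω : ℝ≥0∞) ∂sourceLaw n
      ≤ ENNReal.ofReal (∑ k, 1 / (c k - 1)) := by
  have hm := fun (k : Fin m) (t : ℕ) => measurable_comp_state A b σ α y
    ((resampling A b k).indicator (1 : (Fin n → Bool) → ℝ≥0∞)) t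
  simp_rw [numResamplings_eq_tsum]
  rw [lintegral_tsum fun t => (Finset.measurable_sum _ fun k _ => hm k t).aemeasurable,
    ENNReal.ofReal_sum_of_nonneg fun k _ => one_div_nonneg.2 (sub_nonneg.2 (hc k).le)]
  simp_rw [lintegral_finsetSum _ fun k _ => hm k _]
  rw [Summable.tsum_finsetSum fun _ _ => ENNReal.summable]
  exact Finset.sum_le_sum fun k _ => tsum_resampling_le hA hσ₀ hσ₁ hy k (hc k) (hck k)

theorem halts_of_numResamplings_ne_top {ω : Source n} (h : numResamplings A b σ α y ω ≠ ⊤) :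
    Halts A b σ α y ω := by
  by_contra hn
  simp only [Halts, not_exists, ← ne_eq, ← Finset.nonempty_iff_ne_empty] at hn
  refine h ?_
  rw [numResamplings, Set.eq_univ_of_forall 
    (s := {t : ℕ | (violated A b (state A b σ α y ω t)).Nonempty}) hn]
  exact Set.encard_eq_top Set.infinite_univ

theorem ae_halts (hA : ∀ k i, 0 ≤ A k i ∧ A k i ≤ 1) (hσ₀ : 0 < σ)
    (hσ₁ : σ < 1) (hy : ∀ i, 0 ≤ α * y i ∧ α * y i ≤ 1) {c : Fin m → ℝ} (hc : ∀ k, 1 < c k)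
    (hck : ∀ k, c k ≤ Real.exp (σ * α * ∑ i, A k i * y i) * (1 - σ) ^ b k) :
    ∀ᵐ ω ∂sourceLaw n, Halts A b σ α y ω := by
  filter_upwards [ae_lt_top (measurable_numResamplings A b σ α y)
    ((lintegral_numResamplings_le hA hσ₀ hσ₁ hy hc hck).trans_lt ENNReal.ofReal_lt_top).ne]
    with ω hω
  exact halts_of_numResamplings_ne_top fun h => by simp [h] at hω

/-! ### Expected value of the returned vector. -/

theorem loopStep_le (x : Fin n → Bool) (u : Fin n → unitInterval) (i : Fin n) :
    ((loopStep A b σ α y x u i).toNat : ℝ≥0∞) ≤ (x i).toNat +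
      ∑ k, (resampling A b k).indicator 1 x *
        ((decide ((u i : ℝ) < σ * A k i * α * y i)).toNat : ℝ≥0∞) := by
  by_cases h : (violated A b x).Nonempty
  · set k := (violated A b x).min' h with hk
    have hx : x ∈ resampling A b k := ⟨h, rfl⟩
    have h1 := Finset.single_le_sum (f := fun k => (resampling A b k).indicator 1 x *
        ((decide ((u i : ℝ) < σ * A k i * α * y i)).toNat : ℝ≥0∞)) (s := Finset.univ)
      (fun _ _ => by positivity) (Finset.mem_univ k)
    refine le_trans ?_ (add_le_add_right h1 _)
    rw [Set.indicator_of_mem hx, Pi.one_apply, one_mul, loopStep_of_mem_resampling hx, resample]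
    cases hxi : x i <;> simp
  · simp [loopStep, h]

/-- Each resampling is charged with its draw at `i` even if the entry is already `1`. Each draw is
thus weighted only by an indicator of the preceding state, of which it is independent. -/
theorem state_le (ω : Source n) (i : Fin n) (T : ℕ) :
    ((state A b σ α y ω T i).toNat : ℝ≥0∞) ≤ (state A b σ α y ω 0 i).toNat +
      ∑ t ∈ Finset.range T, ∑ k, (resampling A b k).indicator 1 (state A b σ α y ω t) *
        ((decide ((ω (t + 1) i : ℝ) < σ * A k i * α * y i)).toNat : ℝ≥0∞) := by
  induction T with
  | zero => simp
  | succ T ih =>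
    rw [Finset.sum_range_succ, ← add_assoc]
    exact (loopStep_le _ _ i).trans (add_le_add_left ih _)

theorem lintegral_toNat_decide_lt {s : ℝ} (h0 : 0 ≤ s) (h1 : s ≤ 1) (i : Fin n) :
    ∫⁻ u : Fin n → unitInterval, ((decide ((u i : ℝ) < s)).toNat : ℝ≥0∞) = ENNReal.ofReal s := by
  have hm : Measurable fun u : unitInterval => ((decide ((u : ℝ) < s)).toNat : ℝ≥0∞) :=
    (measurable_of_finite fun c : Bool => (c.toNat : ℝ≥0∞)).comp (measurable_decide_lt s)
  have h := (measurePreserving_eval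
    (fun _ : Fin n => (volume : Measure unitInterval)) i).lintegral_comp hm
  rw [volume_pi]
  refine h.trans ?_
  rw [lintegral_decide_lt h0 h1 fun c => (c.toNat : ℝ≥0∞)]
  simp

theorem lintegral_relaxation_le (hA : ∀ k i, 0 ≤ A k i ∧ A k i ≤ 1) (hσ₀ : 0 < σ)
    (hσ₁ : σ < 1) (hy : ∀ i, 0 ≤ α * y i ∧ α * y i ≤ 1) {c : Fin m → ℝ} (hc : ∀ k, 1 < c k)
    (hck : ∀ k, c k ≤ Real.exp (σ * α * ∑ i, A k i * y i) * (1 - σ) ^ b k) (i : Fin n) :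
    ∫⁻ ω, ((relaxation A b σ α y ω i).toNat : ℝ≥0∞) ∂sourceLaw n
      ≤ ENNReal.ofReal (α * y i * (1 + σ * ∑ k, A k i / (c k - 1))) := by
  set f : Bool → ℝ≥0∞ := fun c => c.toNat with hf
  set s : Fin m → ℝ := fun k => σ * A k i * α * y i with hs
  have hs01 : ∀ k, 0 ≤ s k ∧ s k ≤ 1 := fun k => by
    simpa only [hs, mul_assoc] using (rate_bounds hA hσ₀ hσ₁ hy k i).2
  set g : Fin m → (Fin n → Bool) → (Fin n → unitInterval) → ℝ≥0∞ := fun k x u =>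
    (resampling A b k).indicator 1 x * f (decide ((u i : ℝ) < s k)) with hg
  have hfm : ∀ k, Measurable fun u : Fin n → unitInterval => f (decide ((u i : ℝ) < s k)) :=
    fun k => (measurable_of_finite f).comp
      ((measurable_decide_lt (s k)).comp (measurable_pi_apply i))
  have hgm : ∀ k x, Measurable (g k x) := fun k x => (hfm k).const_mul _
  have hgm' : ∀ k t, Measurable fun ω : Source n => g k (state A b σ α y ω t) (ω (t + 1)) :=
    fun k t => (measurable_comp_state A b σ α y _ t).mul
      ((hfm k).comp (measurable_pi_apply (t + 1)))
  -- `state_le` holds at every time, so it may be applied at the random halting index, including the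
  -- default index of a run that does not end.
  have hpt : ∀ ω, f (relaxation A b σ α y ω i) ≤ f (state A b σ α y ω 0 i) +
      ∑' t : ℕ, ∑ k, g k (state A b σ α y ω t) (ω (t + 1)) := fun ω =>
    (state_le ω i _).trans (add_le_add_right (ENNReal.sum_le_tsum _) _)
  have hgt : ∀ k t, ∫⁻ ω, g k (state A b σ α y ω t) (ω (t + 1)) ∂sourceLaw n
      = (∫⁻ ω, (resampling A b k).indicator 1 (state A b σ α y ω t) ∂sourceLaw n) *
        ENNReal.ofReal (s k) := fun k t => by
    rw [lintegral_state_next A b σ α y t (hgm k), ← lintegral_mul_const _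
      (measurable_comp_state A b σ α y _ t)]
    refine lintegral_congr fun ω => ?_
    rw [hg, lintegral_const_mul _ (hfm k), hf, lintegral_toNat_decide_lt (hs01 k).1 (hs01 k).2]
  have h0 : ∫⁻ ω, f (state A b σ α y ω 0 i) ∂sourceLaw n = ENNReal.ofReal (α * y i) := by
    have hm : Measurable fun u : Fin n → unitInterval => f (decide ((u i : ℝ) < α * y i)) :=
      (measurable_of_finite f).comp ((measurable_decide_lt _).comp (measurable_pi_apply i))
    exact (lintegral_state_zero hm).trans (lintegral_toNat_decide_lt (hy i).1 (hy i).2 i)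
  have hck0 : ∀ k, 0 ≤ 1 / (c k - 1) := fun k => one_div_nonneg.2 (sub_nonneg.2 (hc k).le)
  calc ∫⁻ ω, f (relaxation A b σ α y ω i) ∂sourceLaw n
      ≤ ∫⁻ ω, (f (state A b σ α y ω 0 i) +
          ∑' t : ℕ, ∑ k, g k (state A b σ α y ω t) (ω (t + 1))) ∂sourceLaw n :=
        lintegral_mono hpt
    _ = ENNReal.ofReal (α * y i) + ∑ k, (∑' t : ℕ,
          ∫⁻ ω, (resampling A b k).indicator 1 (state A b σ α y ω t) ∂sourceLaw n) *
            ENNReal.ofReal (s k) := by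
        rw [lintegral_add_left (measurable_comp_state A b σ α y (fun x => f (x i)) 0), h0,
          lintegral_tsum fun t => (Finset.measurable_sum _ fun k _ => hgm' k t).aemeasurable]
        simp_rw [lintegral_finsetSum _ fun k _ => hgm' k _]
        rw [Summable.tsum_finsetSum fun _ _ => ENNReal.summable]
        simp_rw [hgt, ENNReal.tsum_mul_right]
    _ ≤ ENNReal.ofReal (α * y i) + ∑ k, ENNReal.ofReal (1 / (c k - 1)) * ENNReal.ofReal (s k) := by
        gcongr with k
        exact tsum_resampling_le hA hσ₀ hσ₁ hy k (hc k) (hck k)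
    _ = ENNReal.ofReal (α * y i * (1 + σ * ∑ k, A k i / (c k - 1))) := by
        simp_rw [← ENNReal.ofReal_mul (hck0 _)]
        have hnn : ∀ k, 0 ≤ 1 / (c k - 1) * s k := fun k => mul_nonneg (hck0 k) (hs01 k).1
        rw [← ENNReal.ofReal_sum_of_nonneg fun k _ => hnn k,
          ← ENNReal.ofReal_add (hy i).1 (Finset.sum_nonneg fun k _ => hnn k)]
        congr 1
        rw [mul_add, mul_one, ← mul_assoc, Finset.mul_sum]
        congr 1
        refine Finset.sum_congr rfl fun k _ => ?_
        simp only [hs]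
        ring

end Relaxation

/-! ### Analysis of ROUNDING -/

section Rounding

variable {A : Fin m → Fin n → ℝ} {a : Fin m → ℝ} {xh : Fin n → ℝ} {σ α : ℝ}

theorem le_neg_log_one_sub (hσ₁ : σ < 1) : σ ≤ -Real.log (1 - σ) := by
  linarith [Real.log_le_sub_one_of_pos (show 0 < 1 - σ by linarith)]

theorem one_lt_of_neg_log_div_lt (hσ₀ : 0 < σ) (hσ₁ : σ < 1)
    (hα : -Real.log (1 - σ) / σ < α) : 1 < α :=
  ((one_le_div hσ₀).2 (le_neg_log_one_sub hσ₁)).trans_lt hα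

theorem mul_theta (hσ₀ : 0 < σ) (hα₀ : 0 < α) : σ * α * theta σ α = -Real.log (1 - σ) := by
  unfold theta
  field_simp

theorem one_le_mul_theta (hσ₀ : 0 < σ) (hσ₁ : σ < 1) (hα₀ : 0 < α) : 1 ≤ α * theta σ α := by
  refine le_of_mul_le_mul_left ?_ hσ₀
  rw [mul_one, ← mul_assoc, mul_theta hσ₀ hα₀]
  exact le_neg_log_one_sub hσ₁

theorem theta_pos (hσ₀ : 0 < σ) (hσ₁ : σ < 1) (hα₀ : 0 < α) : 0 < theta σ α :=
  pos_of_mul_pos_right (one_pos.trans_le (one_le_mul_theta hσ₀ hσ₁ hα₀)) hα₀.le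

theorem frac_nonneg (hθ : 0 < theta σ α) {i : Fin n} (hx : 0 ≤ xh i) : 0 ≤ frac σ α xh i :=
  sub_nonneg.2 ((le_div_iff₀ hθ).1 (Nat.floor_le (div_nonneg hx hθ.le)))

theorem frac_lt (hθ : 0 < theta σ α) (i : Fin n) : frac σ α xh i < theta σ α := by
  have h := (div_lt_iff₀ hθ).1 (Nat.lt_floor_add_one (xh i / theta σ α))
  simp only [frac, quot]
  linarith

theorem residual_bounds (hα₀ : 0 < α) (hθ : 0 < theta σ α) {i : Fin n} (hx : 0 ≤ xh i) :
    0 ≤ α * residual σ α xh i ∧ α * residual σ α xh i ≤ 1 := by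
  unfold residual
  split_ifs with h
  · simp
  · refine ⟨mul_nonneg hα₀.le (frac_nonneg hθ hx), ?_⟩
    rw [mul_comm]
    exact ((lt_div_iff₀ hα₀).1 (not_le.1 h)).le

/-- Equality when nothing is rounded up; otherwise the discarded remainder is less than the `θ`
credited for the extra unit. -/
theorem le_residual_add (hθ : 0 < theta σ α) (i : Fin n) :
    xh i ≤ residual σ α xh i + theta σ α * (bump σ α xh i + quot σ α xh i) := by
  have h := frac_lt (xh := xh) hθ i
  have he : xh i = frac σ α xh i + quot σ α xh i * theta σ α := by simp [frac]
  unfold residual bump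
  split_ifs
  · push_cast; nlinarith
  · push_cast; linarith

/-- Each whole unit replaces `θ` with `αθ ≥ 1`, and rounding up happens only when `α F_i ≥ 1`, so
neither costs more than `α` times the mass it uses. -/
theorem bump_add_quot_add_le (hσ₀ : 0 < σ) (hσ₁ : σ < 1) (hα₀ : 0 < α) (i : Fin n) :
    (bump σ α xh i : ℝ) + quot σ α xh i + α * residual σ α xh i ≤ α * xh i := by
  have h := one_le_mul_theta hσ₀ hσ₁ hα₀
  have he : xh i = frac σ α xh i + quot σ α xh i * theta σ α := by simp [frac]
  have hv : (quot σ α xh i : ℝ) ≤ α * (quot σ α xh i * theta σ α) := by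
    nlinarith [mul_le_mul_of_nonneg_left h (Nat.cast_nonneg (α := ℝ) (quot σ α xh i))]
  have hx : α * xh i = α * frac σ α xh i + α * (quot σ α xh i * theta σ α) := by
    rw [← mul_add, ← he]
  unfold residual bump
  split_ifs with hb
  · have := (div_le_iff₀' hα₀).1 hb
    push_cast; linarith
  · push_cast; linarith

/-- The logarithm is `c * (σα + ln(1-σ))`; the lower bound on `α` is exactly the positivity of the
bracket. -/
theorem one_lt_exp_mul_rpow (hσ₀ : 0 < σ) (hσ₁ : σ < 1) (hα : -Real.log (1 - σ) / σ < α)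
    {c : ℝ} (hc : 0 < c) : 1 < Real.exp (σ * α * c) * (1 - σ) ^ c := by
  rw [Real.rpow_def_of_pos (by linarith), ← Real.exp_add, Real.one_lt_exp_iff, ← add_mul]
  refine mul_pos ?_ hc
  linarith [(div_lt_iff₀' hσ₀).1 hα]

theorem exp_mul_rpow_le_residual (hA : ∀ k i, 0 ≤ A k i ∧ A k i ≤ 1)
    (hx : FracSolution A a xh) (hσ₀ : 0 < σ) (hσ₁ : σ < 1) (hα₀ : 0 < α) (k : Fin m) :
    Real.exp (σ * α * a k) * (1 - σ) ^ a k
      ≤ Real.exp (σ * α * ∑ i, A k i * residual σ α xh i) *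
        (1 - σ) ^ residualRHS A a σ α xh k := by
  have hpos : 0 < 1 - σ := by linarith
  have hθ := theta_pos hσ₀ hσ₁ hα₀
  -- With `ln(1-σ)` written as `-σαθ`, the comparison of exponents becomes `σα` times the linear
  -- inequality `h`.
  rw [Real.rpow_def_of_pos hpos, Real.rpow_def_of_pos hpos, ← Real.exp_add, ← Real.exp_add,
    Real.exp_le_exp, residualRHS, ← neg_neg (Real.log (1 - σ)), ← mul_theta hσ₀ hα₀]
  set S := ∑ i, A k i * ((bump σ α xh i : ℝ) + quot σ α xh i) with hS
  have h : a k ≤ (∑ i, A k i * residual σ α xh i) + theta σ α * S := by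
    rw [hS, Finset.mul_sum, ← Finset.sum_add_distrib]
    refine (hx.2 k).trans (Finset.sum_le_sum fun i _ => ?_)
    refine (mul_le_mul_of_nonneg_left (le_residual_add hθ i) (hA k i).1).trans_eq ?_
    ring
  have := mul_le_mul_of_nonneg_left h (mul_pos hσ₀ hα₀).le
  linarith

end Rounding

end CoveringIP

open CoveringIP

theorem theorem3p5 {m n : ℕ} (A : Fin m → Fin n → ℝ) (a : Fin m → ℝ) (xh : Fin n → ℝ) (σ α : ℝ)
    (hA : ∀ k i, 0 ≤ A k i ∧ A k i ≤ 1) (ha : ∀ k, 0 < a k)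
    (hx : CoveringIP.FracSolution A a xh)
    (hσ₀ : 0 < σ) (hσ₁ : σ < 1) (hα : -Real.log (1 - σ) / σ < α) :
    (∀ᵐ ω ∂CoveringIP.sourceLaw n,
      CoveringIP.Halts A (CoveringIP.residualRHS A a σ α xh) σ α (CoveringIP.residual σ α xh) ω) ∧
    (∀ i : Fin n,
      Integrable (fun ω => (CoveringIP.rounding A a σ α xh ω i : ℝ)) (CoveringIP.sourceLaw n) ∧
      ∫ ω, (CoveringIP.rounding A a σ α xh ω i : ℝ) ∂CoveringIP.sourceLaw n ≤
        α * xh i *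
          (1 + σ * ∑ k, A k i / (Real.exp (σ * α * a k) * (1 - σ) ^ (a k) - 1))) ∧
    ∫⁻ ω, (CoveringIP.numResamplings A (CoveringIP.residualRHS A a σ α xh) σ α
        (CoveringIP.residual σ α xh) ω : ENNReal) ∂CoveringIP.sourceLaw n ≤
      ENNReal.ofReal (∑ k, 1 / (Real.exp (σ * α * a k) * (1 - σ) ^ (a k) - 1)) := by
  have hα₀ : 0 < α := one_pos.trans (one_lt_of_neg_log_div_lt hσ₀ hσ₁ hα)
  have hθ := theta_pos hσ₀ hσ₁ hα₀
  have hy : ∀ i, 0 ≤ α * residual σ α xh i ∧ α * residual σ α xh i ≤ 1 := fun i =>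
    residual_bounds hα₀ hθ (hx.1 i)
  have hc := fun k => one_lt_exp_mul_rpow hσ₀ hσ₁ hα (ha k)
  have hck := exp_mul_rpow_le_residual hA hx hσ₀ hσ₁ hα₀
  refine ⟨ae_halts hA hσ₀ hσ₁ hy hc hck, fun i => ?_,
    lintegral_numResamplings_le hA hσ₀ hσ₁ hy hc hck⟩
  set X : Source n → ℝ := fun ω =>
    (relaxation A (residualRHS A a σ α xh) σ α (residual σ α xh) ω i).toNat with hX
  set S : ℝ := σ * ∑ k, A k i / (Real.exp (σ * α * a k) * (1 - σ) ^ (a k) - 1) with hS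
  have hS0 : 0 ≤ S := mul_nonneg hσ₀.le (Finset.sum_nonneg fun k _ =>
    div_nonneg (hA k i).1 (sub_nonneg.2 (hc k).le))
  have hXm : Measurable X :=
    (measurable_of_finite fun c : Bool => (c.toNat : ℝ)).comp
      ((measurable_pi_apply i).comp (measurable_relaxation ..))
  have hXi : Integrable X (sourceLaw n) := by
    refine Integrable.of_bound hXm.aestronglyMeasurable 1 (ae_of_all _ fun ω => ?_)
    simp only [hX, Real.norm_natCast]
    exact_mod_cast Bool.toNat_le _
  have hr : (fun ω => (rounding A a σ α xh ω i : ℝ))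
      = fun ω => ((bump σ α xh i : ℝ) + quot σ α xh i) + X ω := by
    funext ω
    simp [rounding, hX]
  have hXle : ∫ ω, X ω ∂sourceLaw n ≤ α * residual σ α xh i * (1 + S) := by
    rw [integral_eq_lintegral_of_nonneg_ae (ae_of_all _ fun ω => Nat.cast_nonneg _)
      hXm.aestronglyMeasurable]
    refine ENNReal.toReal_le_of_le_ofReal (mul_nonneg (hy i).1 (by linarith)) ?_
    simp only [ENNReal.ofReal_natCast]
    exact lintegral_relaxation_le hA hσ₀ hσ₁ hy hc hck i
  rw [hr]
  refine ⟨(integrable_const _).add hXi, ?_⟩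
  rw [integral_add (integrable_const _) hXi, integral_const, probReal_univ, one_smul]
  have h1 := bump_add_quot_add_le (xh := xh) hσ₀ hσ₁ hα₀ i
  have h2 : (0 : ℝ) ≤ (bump σ α xh i : ℝ) + quot σ α xh i := by positivity
  -- Only the random part carries the factor `1 + S`; since `S ≥ 0`, it may be granted to the
  -- deterministic part `G + v` as well, and `h1` applies.
  nlinarith [mul_le_mul_of_nonneg_right h1 hS0, mul_nonneg h2 hS0]
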